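/- Fix $T>0$, a probability space $(\Omega,\mathscr F,\mathbf P)$ and a filtration $(\mathscr F_t)_{0\le t\le T}$ of sub-$\sigma$-algebras of $\mathscr F$ (no completeness or right-continuity is assumed). Let $(N_t)_{0\le t\le T}$ be an adapted point process, i.e. an adapted $\{0,1,2,\dots\}$-valued process whose paths are almost surely nondecreasing and right-continuous with jumps of size $1$, with $\mathbf E N_0<\infty$ (for instance $N_0=0$). Let $(A_t)_{0\le t\le T}$ be a real-valued predictable process whose paths are almost surely nondecreasing and absolutely continuous on $[0,T]$, such that $\mathbf E|A_0|<\infty$ (for instance $A_0=0$), $\mathbf E |A_T|<\infty$ and $$\sigma(A_t:\ t\in[0,T])\subseteq\mathscr F_0 .$$ Then $N_t$ is a Poisson additive process with mean intensity $A_t$ on $[0,T]$ if and only if $(N_t-A_t)_{0\le t\le T}$ is an $(\mathscr F_t)$-martingale. Here $N_t$ is called a Poisson additive process with mean intensity $A_t$ if all of the following hold. 1. $(N,A)$ is continuous in probability: for all $t\in[0,T]$ and $\varepsilon>0$, $\lim_{s\to t}\mathbf P(|N_s-N_t|+|A_s-A_t|\ge\varepsilon)=0$. 2. For all $t_0<t_1<\dots<t_n$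 in $[0,T]$, the increments $N_{t_1}-N_{t_0},\dots,N_{t_n}-N_{t_{n-1}}$ are conditionally independent given $\sigma(A_t:\ t\in[0,T])$. 3. $N_t$ is $\mathscr F_t$-measurable for each $t\in[0,T]$, and $\sigma(A_t:\ t\in[0,T])\subseteq\mathscr F_0$. 4. For all $0\le s<t\le T$ and $n=0,1,2,\dots$, almost surely $$\mathbf P(N_t-N_s=n\mid\mathscr F_s)=\frac{(A_t-A_s)^n e^{A_s-A_t}}{n!}\qquad(0^0=1).$$ 5. For all $0\le s<t\le u<v\le T$, the increments $N_t-N_s$ and $N_v-N_u$ are conditionally independent given $\mathscr F_s$. Real random variables $X_1,\dots,X_n$ are conditionally independent given a $\sigma$-algebra $\mathscr G\subseteq\mathscr F$ if for all Borel sets $B_1,\dots,B_n\subseteq\mathbb R$, almost surely $\mathbf P(X_1\in B_1,\dots,X_n\in B_n\mid\mathscr G)=\prod_{k=1}^n\mathbf P(X_k\in B_k\mid\mathscr G)$. -/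

import Mathlib

open MeasureTheory ProbabilityTheory Filter Set
open scoped NNReal ENNReal Topology

noncomputable section

namespace PoissonAdditive

variable {Ω ι : Type*} {m : MeasurableSpace Ω}

/-- The σ-algebra `σ(Y_t : t ∈ ι)` on `Ω` generated by a real process `Y`. -/
@[reducible]
def sigmaGen (Y : ι → Ω → ℝ) : MeasurableSpace Ω :=
  ⨆ t, (inferInstance : MeasurableSpace ℝ).comap (Y t)

/-- The finitely many real random variables `X_k` are conditionally independent given the
σ-algebra `𝒢`: for all Borel sets `B_k`, almost surely
`P(X_k ∈ B_k for all k | 𝒢) = ∏ k, P(X_k ∈ B_k | 𝒢)`.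
(Mathlib's `iCondIndepFun` is only available on standard Borel spaces.) -/
def CondIndepGiven {κ : Type*} [Fintype κ] (P : Measure Ω) (𝒢 : MeasurableSpace Ω)
    (X : κ → Ω → ℝ) : Prop :=
  ∀ B : κ → Set ℝ, (∀ k, MeasurableSet (B k)) →
    P⟦⋂ k, X k ⁻¹' B k | 𝒢⟧ =ᵐ[P] fun ω ↦ ∏ k, (P⟦X k ⁻¹' B k | 𝒢⟧) ω

/-- `(X, Y)` is a binary conditionally additive process: it is continuous in probability and
`X` has conditionally independent increments given `σ(Y_t : t ∈ ι)`. -/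
structure IsConditionallyAdditive [Preorder ι] [TopologicalSpace ι] (P : Measure Ω)
    (X Y : ι → Ω → ℝ) : Prop where
  continuous_in_probability : ∀ t : ι, ∀ ε : ℝ, 0 < ε →
    Tendsto (fun s ↦ P {ω | ε ≤ |X s ω - X t ω| + |Y s ω - Y t ω|}) (𝓝 t) (𝓝 0)
  condIndep_increments : ∀ (n : ℕ) (t : Fin (n + 1) → ι), StrictMono t →
    CondIndepGiven P (sigmaGen Y) fun (k : Fin n) ω ↦ X (t k.succ) ω - X (t k.castSucc) ω

/-- `(N, A)` is a Poisson additive process with mean intensity `A`, relative to the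
filtration `𝓕` and the probability `P`. -/
structure IsPoissonAdditive [Preorder ι] [OrderBot ι] [TopologicalSpace ι]
    (𝓕 : Filtration ι m) (P : Measure Ω) (N : ι → Ω → ℕ) (A : ι → Ω → ℝ) : Prop where
  condAdditive : IsConditionallyAdditive P (fun t ω ↦ (N t ω : ℝ)) A
  adapted : Adapted 𝓕 N
  sigmaGen_le : sigmaGen A ≤ 𝓕 ⊥
  condPoisson : ∀ s t : ι, s < t → ∀ n : ℕ,
    P⟦{ω | (N t ω : ℝ) - N s ω = n} | 𝓕 s⟧
      =ᵐ[P] fun ω ↦ (A t ω - A s ω) ^ n * Real.exp (A s ω - A t ω) / (n.factorial : ℝ)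
  condIndep : ∀ s t u v : ι, s < t → t ≤ u → u < v →
    CondIndepGiven P (𝓕 s)
      ![fun ω ↦ (N t ω : ℝ) - N s ω, fun ω ↦ (N v ω : ℝ) - N u ω]

/-- The paths of a (simple, finite) point process `N`, i.e. of the counting process
`N_t = N_0 + #{n : T_n ≤ t}` of a locally finite set of distinct arrival times: almost surely
`t ↦ N_t` is nondecreasing, right-continuous, and has jumps of size one. -/
def IsPointProcess [LinearOrder ι] [TopologicalSpace ι] (P : Measure Ω) (N : ι → Ω → ℕ) : Prop :=
  ∀ᵐ ω ∂P, Monotone (fun t ↦ N t ω) ∧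
    (∀ t, ContinuousWithinAt (fun s ↦ N s ω) (Ioi t) t) ∧
    ∀ t, N t ω ≤ Function.leftLim (fun s ↦ N s ω) t + 1

/-- Almost surely the path `t ↦ A_t` is nondecreasing and absolutely continuous on `[0, T]`.
(The path is extended by its value at `T` beyond `T`, and by its value at `0` to negative
numbers, so that Mathlib's notion for functions of a real variable applies.) -/
def IsIncreasingAC (P : Measure Ω) {T : ℝ≥0} (A : Iic T → Ω → ℝ) : Prop :=
  ∀ᵐ ω ∂P, Monotone (fun t ↦ A t ω) ∧
    AbsolutelyContinuousOnInterval
      (fun x : ℝ ↦ IicExtend (fun t : Iic T ↦ A t ω) x.toNNReal) 0 T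

end PoissonAdditive

end

/-! The substance is the passage from the martingale property to the Poisson law. Fix |z| ≤ 1, s ≤ t
and C in `𝓕 s`. As its running time goes from s to t, `interp` moves from exp(-(1-z)(A t - A s)) to
z^(N t - N s). Over one step of a partition its change is a bounded factor times -(1-z)Δ(N - A) +
`powRem` - `expRem`, and the factor is known at the start of the step because the whole of A is
known at time `⊥`. The martingale term integrates to zero over C. The summed remainders vanish with
the mesh: a short step contains at most one unit jump of N, and A is continuous. So the two
endpoints have the same integral over C (`setIntegral_pow_sub_eq`), and comparing coefficients of
powers of z gives the conditional Poisson law (`measureReal_eq_of_setIntegral_pow_eq`).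

This law depends on the past only through A, so it is measurable for any σ-algebra that determines
A; conditioning successively, latest increment first, then gives both conditional independence
statements (`condIndepGiven_increments`). Continuity in probability comes from E|N s - N t| = E|A s
- A t| and Markov's inequality.

Conversely, a Poisson law with parameter x has mean x, so the conditional Poisson law makes the
increments of N - A integrate to zero over past events (`martingale_of_isCondPoisson`). -/

namespace PoissonAdditive

/-! ### Path regularity and partitions of [s, t] -/

section Paths

/-- Locally, a nondecreasing right-continuous integer path with unit jumps grows by at most one. -/
lemma exists_nhds_le_add_one {α : Type*} [LinearOrder α] [TopologicalSpace α] [OrderTopology α]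
    {f : α → ℕ} (hf : Monotone f) (hr : ∀ t, ContinuousWithinAt f (Ioi t) t)
    (hj : ∀ t, f t ≤ Function.leftLim f t + 1) (x : α) :
    ∃ U, IsOpen U ∧ x ∈ U ∧ ∀ y ∈ U, ∀ z ∈ U, f z ≤ f y + 1 := by
  have h : ∀ᶠ y in 𝓝 x, Function.leftLim f x ≤ f y ∧ f y ≤ f x := by
    rw [← nhdsNE_sup_pure, ← nhdsLT_sup_nhdsGT]
    simp only [eventually_sup, eventually_pure]
    refine ⟨⟨?_, ?_⟩, hf.leftLim_le le_rfl, le_rfl⟩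
    -- As ℕ is discrete, the left limit is attained just before x; likewise, right-continuity gives
    -- the value `f x` just after x.
    · have := hf.tendsto_leftLim x
      rw [nhds_discrete, tendsto_pure] at this
      filter_upwards [this, self_mem_nhdsWithin] with y hy hyx
      exact ⟨hy.ge, hf (le_of_lt hyx)⟩
    · have : Tendsto f (𝓝[>] x) (𝓝 (f x)) := hr x
      rw [nhds_discrete, tendsto_pure] at this
      filter_upwards [this] with y hy
      exact ⟨hy ▸ hf.leftLim_le le_rfl, hy.le⟩
  obtain ⟨U, hU, hUo, hxU⟩ := eventually_nhds_iff.1 h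
  refine ⟨U, hUo, hxU, fun y hy z hz ↦ ?_⟩
  have h1 := hU y hy
  have h2 := hU z hz
  have h3 := hj x
  omega

variable {T : ℝ≥0}

instance compactSpace_Iic : CompactSpace (Iic T) :=
  isCompact_iff_compactSpace.1 (by rw [← Icc_bot]; exact isCompact_Icc)

/-- A Lebesgue number of the cover by the local neighbourhoods makes the bound uniform over the
compact time interval. -/
lemma exists_pos_forall_dist_lt_le_add_one {f : Iic T → ℕ} (hf : Monotone f)
    (hr : ∀ t, ContinuousWithinAt f (Ioi t) t) (hj : ∀ t, f t ≤ Function.leftLim f t + 1) :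
    ∃ δ > 0, ∀ y z, dist y z < δ → f z ≤ f y + 1 := by
  choose U hUo hxU hU using exists_nhds_le_add_one hf hr hj
  obtain ⟨δ, hδ, h⟩ := lebesgue_number_lemma_of_metric (isCompact_univ (X := Iic T)) hUo
    (fun x _ ↦ mem_iUnion.2 ⟨x, hxU x⟩)
  refine ⟨δ, hδ, fun y z hyz ↦ ?_⟩
  obtain ⟨i, hi⟩ := h y trivial
  exact hU i y (hi (Metric.mem_ball_self hδ)) z (hi (by rwa [Metric.mem_ball, dist_comm]))

lemma continuous_of_absolutelyContinuousOnInterval {a : Iic T → ℝ}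
    (ha : AbsolutelyContinuousOnInterval (fun x : ℝ ↦ IicExtend a x.toNNReal) 0 T) :
    Continuous a := by
  have h := ha.continuousOn
  rw [uIcc_of_le T.coe_nonneg] at h
  have h2 : Continuous fun t : Iic T ↦ (fun x : ℝ ↦ IicExtend a x.toNNReal) ((t : ℝ≥0) : ℝ) :=
    h.comp_continuous (by fun_prop) fun t ↦ ⟨NNReal.coe_nonneg _, NNReal.coe_le_coe.2 t.2⟩
  simpa using h2

/-- The points `s + k T / (n + 1)`, stopped at `t`. -/
noncomputable def grid (s t : Iic T) (n k : ℕ) : Iic T :=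
  ⟨min t (s + k * (T / (n + 1))), mem_Iic.2 ((min_le_left _ _).trans t.2)⟩

lemma grid_zero {s t : Iic T} (h : s ≤ t) (n : ℕ) : grid s t n 0 = s := by
  ext; simpa [grid] using h

lemma grid_last (s t : Iic T) (n : ℕ) : grid s t n (n + 1) = t := by
  have h : ((n + 1 : ℕ) : ℝ≥0) * (T / (n + 1)) = T := by
    push_cast; exact mul_div_cancel₀ _ (by positivity)
  refine Subtype.ext (min_eq_left ?_)
  rw [h]
  exact le_add_left t.2

lemma grid_mono (s t : Iic T) (n : ℕ) : Monotone (grid s t n) := by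
  intro i j hij
  have : (i : ℝ≥0) ≤ j := by exact_mod_cast hij
  exact min_le_min_left (t : ℝ≥0) (by gcongr : (s : ℝ≥0) + i * (T / (n + 1)) ≤ s + j * (T / (n + 1)))

lemma grid_le (s t : Iic T) (n k : ℕ) : grid s t n k ≤ t :=
  min_le_left (t : ℝ≥0) _

lemma le_grid {s t : Iic T} (h : s ≤ t) (n k : ℕ) : s ≤ grid s t n k := by
  simpa only [grid_zero h] using grid_mono s t n (Nat.zero_le k)

lemma dist_grid_le (s t : Iic T) (n k : ℕ) :
    dist (grid s t n k) (grid s t n (k + 1)) ≤ T / (n + 1) := by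
  have h : dist (grid s t n k) (grid s t n (k + 1))
      = |min (t : ℝ) (s + k * (T / (n + 1))) - min (t : ℝ) (s + (k + 1 : ℕ) * (T / (n + 1)))| := by
    rw [Subtype.dist_eq, NNReal.dist_eq]
    simp [grid]
  rw [h]
  refine (abs_min_sub_min_le_max _ _ _ _).trans ?_
  have h0 : (0 : ℝ) ≤ T / (n + 1) := by positivity
  rw [sub_self, abs_zero, max_eq_right (abs_nonneg _)]
  push_cast
  rw [show (s : ℝ) + k * (T / (n + 1)) - (s + (k + 1) * (T / (n + 1))) = -(T / (n + 1)) by ring,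
    abs_neg, abs_of_nonneg h0]

lemma eventually_forall_dist_grid_lt (s t : Iic T) {δ : ℝ} (hδ : 0 < δ) :
    ∀ᶠ n : ℕ in atTop, ∀ k, dist (grid s t n k) (grid s t n (k + 1)) < δ := by
  have h : Tendsto (fun n : ℕ ↦ (T : ℝ) / (n + 1)) atTop (𝓝 0) := by
    simpa [div_eq_mul_inv] using (tendsto_one_div_add_atTop_nhds_zero_nat (𝕜 := ℝ)).const_mul (T : ℝ)
  filter_upwards [h.eventually (gt_mem_nhds hδ)] with n hn k
  exact (dist_grid_le s t n k).trans_lt hn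

end Paths

/-! ### Second order remainders and uniqueness of power series -/

section Remainders

/-- The second order remainder of `z ^ n` at `z = 1`. -/
noncomputable def powRem (z : ℝ) (n : ℕ) : ℝ := z ^ n - 1 + (1 - z) * n

/-- The second order remainder of `exp (-(1 - z) x)` at `x = 0`. -/
noncomputable def expRem (z x : ℝ) : ℝ := Real.exp (-((1 - z) * x)) - 1 + (1 - z) * x

variable {z : ℝ}

/-- This is Bernoulli's inequality, available because z - 1 ≥ -2. -/
lemma powRem_nonneg (hz : |z| ≤ 1) (n : ℕ) : 0 ≤ powRem z n := by
  have h := one_add_mul_le_pow (a := z - 1) (by linarith [(abs_le.1 hz).1]) n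
  rw [add_sub_cancel] at h
  unfold powRem
  linarith

lemma powRem_le (hz : |z| ≤ 1) (n : ℕ) : powRem z n ≤ 2 * n := by
  have h : z ^ n ≤ 1 := (le_abs_self _).trans (by rw [abs_pow]; exact pow_le_one₀ (abs_nonneg _) hz)
  have h2 : (1 - z) * n ≤ 2 * n := by
    gcongr; linarith [(abs_le.1 hz).1]
  unfold powRem
  linarith

lemma powRem_eq_zero {n : ℕ} (hn : n ≤ 1) : powRem z n = 0 := by
  unfold powRem
  interval_cases n <;> simp

lemma expRem_nonneg (x : ℝ) : 0 ≤ expRem z x := by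
  unfold expRem
  linarith [Real.add_one_le_exp (-((1 - z) * x))]

lemma expRem_le (hz : |z| ≤ 1) {x : ℝ} (hx : 0 ≤ x) : expRem z x ≤ 2 * x := by
  have h0 : 0 ≤ (1 - z) * x := mul_nonneg (by linarith [(abs_le.1 hz).2]) hx
  have h : Real.exp (-((1 - z) * x)) ≤ 1 := Real.exp_le_one_iff.2 (by linarith)
  have h2 : (1 - z) * x ≤ 2 * x := by
    gcongr; linarith [(abs_le.1 hz).1]
  unfold expRem
  linarith

/-- Since 0 ≤ 1 - z ≤ 2, the restriction x ≤ 1/2 keeps (1-z)x within [0, 1], where the quadratic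
bound for exp applies. -/
lemma expRem_le_sq (hz : |z| ≤ 1) {x : ℝ} (hx : 0 ≤ x) (hx1 : x ≤ 1 / 2) :
    expRem z x ≤ 4 * x ^ 2 := by
  have h1 : (1 - z) * x ≤ 2 * x := by
    gcongr; linarith [(abs_le.1 hz).1]
  have h0 : 0 ≤ (1 - z) * x := mul_nonneg (by linarith [(abs_le.1 hz).2]) hx
  have h := Real.abs_exp_sub_one_sub_id_le (x := -((1 - z) * x))
    (by rw [abs_neg, abs_of_nonneg h0]; linarith)
  have h3 : ((1 - z) * x) ^ 2 ≤ (2 * x) ^ 2 := by gcongr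
  unfold expRem
  have := le_abs_self (Real.exp (-((1 - z) * x)) - 1 - -((1 - z) * x))
  nlinarith

variable {T : ℝ≥0}

/-- For a fine enough grid every increment is 0 or 1, where `powRem` vanishes, so the sums are
eventually exactly zero. -/
lemma tendsto_sum_powRem {f : Iic T → ℕ} (hf : Monotone f)
    (hr : ∀ t, ContinuousWithinAt f (Ioi t) t) (hj : ∀ t, f t ≤ Function.leftLim f t + 1)
    (s t : Iic T) :
    Tendsto (fun n ↦ ∑ k ∈ Finset.range (n + 1),
      powRem z (f (grid s t n (k + 1)) - f (grid s t n k))) atTop (𝓝 0) := by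
  obtain ⟨δ, hδ, h⟩ := exists_pos_forall_dist_lt_le_add_one hf hr hj
  refine tendsto_const_nhds.congr' ?_
  filter_upwards [eventually_forall_dist_grid_lt s t hδ] with n hn
  refine (Finset.sum_eq_zero fun k _ ↦ powRem_eq_zero ?_).symm
  have := h _ _ (hn k)
  omega

lemma tendsto_sum_expRem (hz : |z| ≤ 1) {a : Iic T → ℝ} (ha : Monotone a) (hc : Continuous a)
    {s t : Iic T} (hst : s ≤ t) :
    Tendsto (fun n ↦ ∑ k ∈ Finset.range (n + 1),
      expRem z (a (grid s t n (k + 1)) - a (grid s t n k))) atTop (𝓝 0) := by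
  have huc := CompactSpace.uniformContinuous_of_continuous hc
  rw [Metric.tendsto_atTop']
  intro ε hε
  have hD : 0 ≤ a t - a s := sub_nonneg.2 (ha hst)
  -- With increments at most η, the quadratic bound telescopes to 4η(a t - a s). The extra 1 in the
  -- denominator keeps it positive and makes the final inequality strict.
  set η : ℝ := min (1 / 2) (ε / (4 * (a t - a s) + 1)) with hη
  have hη0 : 0 < η := by positivity
  obtain ⟨δ, hδ, h⟩ := Metric.uniformContinuous_iff.1 huc η hη0
  obtain ⟨M, hM⟩ := eventually_atTop.1 (eventually_forall_dist_grid_lt s t hδ)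
  refine ⟨M, fun n hn ↦ ?_⟩
  have hsum : ∑ k ∈ Finset.range (n + 1), expRem z (a (grid s t n (k + 1)) - a (grid s t n k))
      ≤ ∑ k ∈ Finset.range (n + 1), 4 * η * (a (grid s t n (k + 1)) - a (grid s t n k)) := by
    refine Finset.sum_le_sum fun k _ ↦ ?_
    have h0 : 0 ≤ a (grid s t n (k + 1)) - a (grid s t n k) :=
      sub_nonneg.2 (ha (grid_mono s t n k.le_succ))
    have h1 : a (grid s t n (k + 1)) - a (grid s t n k) ≤ η := by
      have := h (hM n hn.le k)
      rw [dist_comm, Real.dist_eq] at this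
      exact (le_abs_self _).trans this.le
    refine (expRem_le_sq hz h0 (h1.trans (min_le_left _ _))).trans ?_
    nlinarith
  rw [← Finset.mul_sum, Finset.sum_range_sub (fun k ↦ a (grid s t n k)), grid_last,
    grid_zero hst] at hsum
  rw [Real.dist_eq, sub_zero, abs_of_nonneg (Finset.sum_nonneg fun k _ ↦ expRem_nonneg _)]
  refine hsum.trans_lt ?_
  have h4 : η * (4 * (a t - a s) + 1) ≤ ε := by
    have := min_le_right (1 / 2) (ε / (4 * (a t - a s) + 1))
    rwa [← hη, le_div_iff₀ (by positivity)] at this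
  nlinarith

/-- Real power series which agree on `[-1, 1]` have the same coefficients. -/
lemma eq_of_hasSum_pow_mul {a b : ℕ → ℝ} {f : ℝ → ℝ}
    (ha : ∀ z, |z| ≤ 1 → HasSum (fun n ↦ z ^ n * a n) (f z))
    (hb : ∀ z, |z| ≤ 1 → HasSum (fun n ↦ z ^ n * b n) (f z)) : a = b := by
  have key : ∀ c : ℕ → ℝ, (∀ z, |z| ≤ 1 → HasSum (fun n ↦ z ^ n * c n) (f z)) →
      HasFPowerSeriesAt f (FormalMultilinearSeries.ofScalars ℝ c) 0 := by
    intro c hc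
    rw [hasFPowerSeriesAt_iff]
    filter_upwards [Metric.closedBall_mem_nhds (0 : ℝ) one_pos] with z hz
    simpa [FormalMultilinearSeries.coeff_ofScalars] using hc z (by simpa using hz)
  have h := (key a ha).eq_formalMultilinearSeries (key b hb)
  ext n
  have := congrArg (fun p ↦ FormalMultilinearSeries.coeff p n) h
  simpa [FormalMultilinearSeries.coeff_ofScalars] using this

end Remainders

section

variable {Ω : Type*} {m : MeasurableSpace Ω} {P : Measure Ω}

/-! ### From the martingale property to the conditional generating function -/

section Watanabe

/-- The increments of a martingale are orthogonal to bounded functions of the past. -/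
lemma integral_mul_martingale_sub [IsProbabilityMeasure P] {ι : Type*} [Preorder ι] {𝓕 : Filtration ι m}
    {M : ι → Ω → ℝ} (hM : Martingale M 𝓕 P) {a b : ι} (hab : a ≤ b) {d : Ω → ℝ} {K : ℝ}
    (hd : StronglyMeasurable[𝓕 a] d) (hd1 : ∀ᵐ ω ∂P, ‖d ω‖ ≤ K) :
    ∫ ω, d ω * (M b ω - M a ω) ∂P = 0 := by
  have hi : Integrable (M b - M a) P := (hM.integrable b).sub (hM.integrable a)
  have hdi : Integrable (d * (M b - M a)) P :=
    hi.bdd_mul (hd.mono (𝓕.le a)).aestronglyMeasurable hd1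
  have h1 := condExp_mul_of_stronglyMeasurable_left hd hdi hi
  have h2 : P[M b - M a | 𝓕 a] =ᵐ[P] 0 := by
    filter_upwards [condExp_sub (hM.integrable b) (hM.integrable a) (𝓕 a), hM.condExp_ae_eq hab,
      hM.condExp_ae_eq (le_refl a)] with ω h3 h4 h5
    simp [h3, h4, h5]
  rw [← integral_condExp (𝓕.le a)]
  refine integral_eq_zero_of_ae ?_
  filter_upwards [h1, h2] with ω h3 h4
  exact h3.trans (by simp [h4])

variable {T : ℝ≥0} {𝓕 : Filtration (Iic T) m} {N : Iic T → Ω → ℕ} {A : Iic T → Ω → ℝ}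

/-- The process interpolating between `exp (-(1 - z) (A t - A s))` and `z ^ (N t - N s)`. -/
noncomputable def interp (N : Iic T → Ω → ℕ) (A : Iic T → Ω → ℝ) (z : ℝ) (s t a : Iic T) (ω : Ω) :
    ℝ :=
  z ^ (N a ω - N s ω) * Real.exp (-((1 - z) * (A t ω - A a ω)))

lemma measurable_interp (hN : Adapted 𝓕 N) (hA : ∀ t, Measurable[𝓕 ⊥] (A t)) (z : ℝ)
    {s t a : Iic T} (hsa : s ≤ a) : Measurable[𝓕 a] (interp N A z s t a) := by
  have h1 : Measurable[𝓕 a] fun ω ↦ N a ω - N s ω :=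
    (hN a).sub ((hN s).mono (𝓕.mono hsa) le_rfl)
  have hA' : ∀ u, Measurable[𝓕 a] (A u) := fun u ↦ (hA u).mono (𝓕.mono bot_le) le_rfl
  exact ((Measurable.of_discrete (f := fun n : ℕ ↦ z ^ n)).comp h1).mul
    (((hA' t).sub (hA' a)).const_mul _).neg.exp

lemma abs_interp_le {z : ℝ} (hz : |z| ≤ 1) {ω : Ω} {s t a : Iic T} (hat : A a ω ≤ A t ω) :
    |interp N A z s t a ω| ≤ 1 := by
  have h0 : 0 ≤ (1 - z) * (A t ω - A a ω) :=
    mul_nonneg (by linarith [(abs_le.1 hz).2]) (sub_nonneg.2 hat)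
  rw [interp, abs_mul, abs_pow, Real.abs_exp]
  exact mul_le_one₀ (pow_le_one₀ (abs_nonneg _) hz) (Real.exp_pos _).le
    (Real.exp_le_one_iff.2 (by linarith))

lemma integrable_interp [IsProbabilityMeasure P] (hN : Adapted 𝓕 N) (hA : ∀ t, Measurable[𝓕 ⊥] (A t))
    (hAm : ∀ᵐ ω ∂P, Monotone fun t ↦ A t ω) {z : ℝ} (hz : |z| ≤ 1) {s t a : Iic T} (hsa : s ≤ a)
    (hat : a ≤ t) : Integrable (interp N A z s t a) P := by
  refine Integrable.of_bound
    ((measurable_interp hN hA z hsa).mono (𝓕.le a) le_rfl).aestronglyMeasurable 1 ?_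
  filter_upwards [hAm] with ω h
  exact abs_interp_le hz (h hat)

/-- The sum of the remainders over one step. -/
noncomputable def stepRem (N : Iic T → Ω → ℕ) (A : Iic T → Ω → ℝ) (z : ℝ) (a b : Iic T) (ω : Ω) :
    ℝ :=
  powRem z (N b ω - N a ω) + expRem z (A b ω - A a ω)

lemma measurable_expRem (z : ℝ) : Measurable (expRem z) := by
  unfold expRem
  fun_prop

lemma measurable_stepRem (hN : ∀ t, Measurable (N t)) (hA : ∀ t, Measurable (A t)) (z : ℝ)
    (a b : Iic T) : Measurable (stepRem N A z a b) :=
  ((Measurable.of_discrete (f := powRem z)).comp ((hN b).sub (hN a))).add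
    ((measurable_expRem z).comp ((hA b).sub (hA a)))

lemma stepRem_nonneg {z : ℝ} (hz : |z| ≤ 1) (a b : Iic T) (ω : Ω) : 0 ≤ stepRem N A z a b ω :=
  add_nonneg (powRem_nonneg hz _) (expRem_nonneg _)

lemma stepRem_le {z : ℝ} (hz : |z| ≤ 1) {a b : Iic T} {ω : Ω} (hN : N a ω ≤ N b ω)
    (hA : A a ω ≤ A b ω) :
    stepRem N A z a b ω ≤ 2 * ((N b ω : ℝ) - N a ω) + 2 * (A b ω - A a ω) := by
  rw [← Nat.cast_sub hN]
  exact add_le_add (powRem_le hz _) (expRem_le hz (sub_nonneg.2 hA))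

lemma integrable_stepRem (hN : ∀ t, Measurable (N t)) (hA : ∀ t, Measurable (A t))
    (hNm : ∀ᵐ ω ∂P, Monotone fun t ↦ N t ω) (hAm : ∀ᵐ ω ∂P, Monotone fun t ↦ A t ω)
    (hNi : ∀ t, Integrable (fun ω ↦ (N t ω : ℝ)) P) (hAi : ∀ t, Integrable (A t) P)
    {z : ℝ} (hz : |z| ≤ 1) {a b : Iic T} (hab : a ≤ b) : Integrable (stepRem N A z a b) P := by
  refine Integrable.mono' ((((hNi b).sub (hNi a)).const_mul 2).add
    (((hAi b).sub (hAi a)).const_mul 2)) (measurable_stepRem hN hA z a b).aestronglyMeasurable ?_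
  filter_upwards [hNm, hAm] with ω h1 h2
  rw [Real.norm_of_nonneg (stepRem_nonneg hz a b ω)]
  exact stepRem_le hz (h1 hab) (h2 hab)

/-- Adding a multiple of a martingale increment, which has zero integral over C, cancels the first
order part of the change and leaves only the remainders. -/
lemma abs_setIntegral_interp_sub_le [IsProbabilityMeasure P] (hN : Adapted 𝓕 N) (hA : ∀ t, Measurable[𝓕 ⊥] (A t))
    (hNm : ∀ᵐ ω ∂P, Monotone fun t ↦ N t ω) (hAm : ∀ᵐ ω ∂P, Monotone fun t ↦ A t ω)
    (hNi : ∀ t, Integrable (fun ω ↦ (N t ω : ℝ)) P) (hAi : ∀ t, Integrable (A t) P)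
    (hM : Martingale (fun t ω ↦ (N t ω : ℝ) - A t ω) 𝓕 P)
    {z : ℝ} (hz : |z| ≤ 1) {s a b t : Iic T} (hsa : s ≤ a) (hab : a ≤ b) (hbt : b ≤ t)
    {C : Set Ω} (hC : MeasurableSet[𝓕 s] C) :
    |∫ ω in C, interp N A z s t b ω ∂P - ∫ ω in C, interp N A z s t a ω ∂P|
      ≤ ∫ ω, stepRem N A z a b ω ∂P := by
  have hA' : ∀ u, Measurable[𝓕 a] (A u) := fun u ↦ (hA u).mono (𝓕.mono bot_le) le_rfl
  -- The factor common to both values of `interp`. It involves A at the later times b and t, yet is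
  -- `𝓕 a`-measurable because A is `𝓕 ⊥`-measurable.
  set c : Ω → ℝ := fun ω ↦ z ^ (N a ω - N s ω) * Real.exp (-((1 - z) * (A t ω - A b ω))) with hc
  have hcm : Measurable[𝓕 a] c :=
    ((Measurable.of_discrete (f := fun n : ℕ ↦ z ^ n)).comp
      ((hN a).sub ((hN s).mono (𝓕.mono hsa) le_rfl))).mul
      (((hA' t).sub (hA' b)).const_mul _).neg.exp
  have hc1 : ∀ᵐ ω ∂P, |c ω| ≤ 1 := by
    filter_upwards [hAm] with ω h
    have h0 : 0 ≤ (1 - z) * (A t ω - A b ω) :=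
      mul_nonneg (by linarith [(abs_le.1 hz).2]) (sub_nonneg.2 (h hbt))
    rw [hc, abs_mul, abs_pow, Real.abs_exp]
    exact mul_le_one₀ (pow_le_one₀ (abs_nonneg _) hz) (Real.exp_pos _).le
      (Real.exp_le_one_iff.2 (by linarith))
  have hCa : MeasurableSet[𝓕 a] C := 𝓕.mono hsa _ hC
  have hCm : MeasurableSet C := 𝓕.le s _ hC
  have hi := integrable_interp (P := P) (N := N) hN hA hAm hz (hsa.trans hab) hbt
  have hi' := integrable_interp (P := P) (N := N) hN hA hAm hz hsa (hab.trans hbt)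
  have hzero : ∫ ω in C, c ω * (((N b ω : ℝ) - A b ω) - (N a ω - A a ω)) ∂P = 0 := by
    rw [← integral_indicator hCm]
    rw [← integral_mul_martingale_sub hM hab (d := C.indicator c) (K := 1)
      (hcm.stronglyMeasurable.indicator hCa)]
    · congr 1 with ω
      by_cases hω : ω ∈ C <;> simp [hω]
    · filter_upwards [hc1] with ω h
      exact (norm_indicator_le_norm_self _ _).trans h
  have hMi : Integrable (fun ω ↦ c ω * (((N b ω : ℝ) - A b ω) - (N a ω - A a ω))) P :=
    (((hNi b).sub (hAi b)).sub ((hNi a).sub (hAi a))).bdd_mul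
      (hcm.mono (𝓕.le a) le_rfl).aestronglyMeasurable hc1
  have hS := integrable_stepRem (fun t ↦ (hN t).mono (𝓕.le t) le_rfl)
    (fun t ↦ (hA t).mono (𝓕.le _) le_rfl) hNm hAm hNi hAi hz hab
  have hpt : ∀ᵐ ω ∂P, |interp N A z s t b ω - interp N A z s t a ω
      + (1 - z) * (c ω * (((N b ω : ℝ) - A b ω) - (N a ω - A a ω)))| ≤ stepRem N A z a b ω := by
    filter_upwards [hNm, hAm, hc1] with ω h1 h2 h3
    have e1 : interp N A z s t b ω = c ω * z ^ (N b ω - N a ω) := by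
      have : N b ω - N s ω = (N a ω - N s ω) + (N b ω - N a ω) := by
        have := h1 hsa; have := h1 hab; dsimp at *; omega
      rw [interp, this, pow_add, hc]; ring
    have e2 : interp N A z s t a ω = c ω * Real.exp (-((1 - z) * (A b ω - A a ω))) := by
      rw [interp, hc, mul_assoc, ← Real.exp_add]; ring_nf
    have e3 : interp N A z s t b ω - interp N A z s t a ω
        + (1 - z) * (c ω * (((N b ω : ℝ) - A b ω) - (N a ω - A a ω)))
        = c ω * (powRem z (N b ω - N a ω) - expRem z (A b ω - A a ω)) := by
      rw [e1, e2, powRem, expRem, Nat.cast_sub (h1 hab)]; ring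
    rw [e3, abs_mul]
    have p1 := powRem_nonneg hz (N b ω - N a ω)
    have p2 := expRem_nonneg (z := z) (A b ω - A a ω)
    -- Since |c| ≤ 1 and both remainders are nonnegative, their difference is bounded in absolute
    -- value by their sum.
    refine (mul_le_of_le_one_left (abs_nonneg _) h3).trans ?_
    rw [stepRem, abs_le]
    constructor <;> linarith
  have hsum : ∫ ω in C, interp N A z s t b ω ∂P - ∫ ω in C, interp N A z s t a ω ∂P
      = ∫ ω in C, (interp N A z s t b ω - interp N A z s t a ω
        + (1 - z) * (c ω * (((N b ω : ℝ) - A b ω) - (N a ω - A a ω)))) ∂P := by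
    have hii : Integrable (fun ω ↦ interp N A z s t b ω - interp N A z s t a ω) P := hi.sub hi'
    rw [integral_add hii.integrableOn (hMi.const_mul _).integrableOn,
      integral_const_mul, hzero, mul_zero, add_zero,
      integral_sub hi.integrableOn hi'.integrableOn]
  rw [hsum]
  refine abs_integral_le_integral_abs.trans ?_
  refine (setIntegral_mono_ae_restrict
    ((hi.sub hi').add (hMi.const_mul _)).abs.integrableOn hS.integrableOn
    (ae_restrict_of_ae hpt)).trans ?_
  exact setIntegral_le_integral hS (Eventually.of_forall fun ω ↦ stepRem_nonneg hz a b ω)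

theorem setIntegral_pow_sub_eq [IsProbabilityMeasure P] (hN : Adapted 𝓕 N) (hA : ∀ t, Measurable[𝓕 ⊥] (A t))
    (hNp : IsPointProcess P N) (hAp : IsIncreasingAC P A)
    (hNi : ∀ t, Integrable (fun ω ↦ (N t ω : ℝ)) P) (hAi : ∀ t, Integrable (A t) P)
    (hM : Martingale (fun t ω ↦ (N t ω : ℝ) - A t ω) 𝓕 P)
    {z : ℝ} (hz : |z| ≤ 1) {s t : Iic T} (hst : s ≤ t) {C : Set Ω} (hC : MeasurableSet[𝓕 s] C) :
    ∫ ω in C, z ^ (N t ω - N s ω) ∂P = ∫ ω in C, Real.exp (-((1 - z) * (A t ω - A s ω))) ∂P := by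
  have hNm : ∀ᵐ ω ∂P, Monotone fun t ↦ N t ω := hNp.mono fun ω h ↦ h.1
  have hAm : ∀ᵐ ω ∂P, Monotone fun t ↦ A t ω := hAp.mono fun ω h ↦ h.1
  have hN' : ∀ t, Measurable (N t) := fun t ↦ (hN t).mono (𝓕.le t) le_rfl
  have hA' : ∀ t, Measurable (A t) := fun t ↦ (hA t).mono (𝓕.le _) le_rfl
  set S : ℕ → Ω → ℝ := fun n ω ↦
    ∑ k ∈ Finset.range (n + 1), stepRem N A z (grid s t n k) (grid s t n (k + 1)) ω with hS
  have hbound : ∀ n, |∫ ω in C, interp N A z s t t ω ∂P - ∫ ω in C, interp N A z s t s ω ∂P|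
      ≤ ∫ ω, S n ω ∂P := by
    intro n
    have htel := Finset.sum_range_sub
      (fun k ↦ ∫ ω in C, interp N A z s t (grid s t n k) ω ∂P) (n + 1)
    simp only [grid_last, grid_zero hst] at htel
    rw [← htel, hS, integral_finsetSum _ fun k _ ↦ integrable_stepRem hN' hA' hNm hAm hNi hAi hz
      (grid_mono s t n k.le_succ)]
    refine (Finset.abs_sum_le_sum_abs _ _).trans (Finset.sum_le_sum fun k _ ↦ ?_)
    exact abs_setIntegral_interp_sub_le hN hA hNm hAm hNi hAi hM hz (le_grid hst n k)
      (grid_mono s t n k.le_succ) (grid_le s t n _) hC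
  have hlim : Tendsto (fun n ↦ ∫ ω, S n ω ∂P) atTop (𝓝 (∫ _, 0 ∂P)) := by
    -- The linear bounds on the remainders telescope over the grid, which gives a dominating
    -- function independent of n.
    refine tendsto_integral_of_dominated_convergence
      (fun ω ↦ 2 * ((N t ω : ℝ) - N s ω) + 2 * (A t ω - A s ω)) (fun n ↦ ?_)
      ((((hNi t).sub (hNi s)).const_mul 2).add (((hAi t).sub (hAi s)).const_mul 2)) (fun n ↦ ?_) ?_
    · exact (Finset.measurable_fun_sum _
        fun k _ ↦ measurable_stepRem hN' hA' z _ _).aestronglyMeasurable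
    · filter_upwards [hNm, hAm] with ω h1 h2
      rw [Real.norm_of_nonneg (Finset.sum_nonneg fun k _ ↦ stepRem_nonneg hz _ _ ω)]
      refine (Finset.sum_le_sum fun k _ ↦ stepRem_le hz (h1 (grid_mono s t n k.le_succ))
        (h2 (grid_mono s t n k.le_succ))).trans_eq ?_
      rw [Finset.sum_add_distrib, ← Finset.mul_sum, ← Finset.mul_sum,
        Finset.sum_range_sub (fun k ↦ A (grid s t n k) ω),
        Finset.sum_range_sub (fun k ↦ (N (grid s t n k) ω : ℝ)), grid_last, grid_zero hst]
    · filter_upwards [hNp, hAp] with ω h1 h2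
      have := (tendsto_sum_powRem (z := z) h1.1 h1.2.1 h1.2.2 s t).add
        (tendsto_sum_expRem hz h2.1 (continuous_of_absolutelyContinuousOnInterval h2.2) hst)
      simpa only [hS, stepRem, Finset.sum_add_distrib, add_zero] using this
  rw [integral_zero] at hlim
  -- The left side of `hbound` does not depend on n, so it is at most the limit 0.
  have h0 := abs_nonpos_iff.1 (ge_of_tendsto' hlim hbound)
  simpa [interp] using sub_eq_zero.1 h0

end Watanabe

end

/-! ### Poisson weights and mixed Poisson laws -/

section PoissonWeights

/-- The Poisson weight `x ^ n e ^ (-x) / n!`. -/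
noncomputable def poissonWeight (n : ℕ) (x : ℝ) : ℝ := x ^ n * Real.exp (-x) / (n.factorial : ℝ)

lemma poissonWeight_nonneg (n : ℕ) {x : ℝ} (hx : 0 ≤ x) : 0 ≤ poissonWeight n x := by
  unfold poissonWeight; positivity

lemma measurable_poissonWeight (n : ℕ) : Measurable (poissonWeight n) := by
  unfold poissonWeight; fun_prop

lemma hasSum_pow_mul_poissonWeight (z x : ℝ) :
    HasSum (fun n ↦ z ^ n * poissonWeight n x) (Real.exp (-((1 - z) * x))) := by
  have h := (NormedSpace.expSeries_div_hasSum_exp (z * x)).mul_right (Real.exp (-x))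
  rw [← Real.exp_eq_exp_ℝ, ← Real.exp_add, show z * x + -x = -((1 - z) * x) by ring] at h
  refine h.congr_fun fun n ↦ ?_
  rw [poissonWeight, mul_pow]; ring

lemma hasSum_poissonWeight (x : ℝ) : HasSum (fun n ↦ poissonWeight n x) 1 := by
  simpa using hasSum_pow_mul_poissonWeight 1 x

lemma hasSum_nat_mul_poissonWeight (x : ℝ) :
    HasSum (fun n : ℕ ↦ (n : ℝ) * poissonWeight n x) x := by
  -- The term n = 0 vanishes, and after the shift (n+1) times the weight at n+1 is x times the
  -- weight at n.
  rw [← hasSum_nat_add_iff' 1]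
  have h := (hasSum_poissonWeight x).mul_left x
  simp only [Finset.sum_range_one, Nat.cast_zero, zero_mul, sub_zero]
  rw [mul_one] at h
  refine h.congr_fun fun n ↦ ?_
  rw [poissonWeight, poissonWeight, Nat.factorial_succ]
  push_cast
  field_simp
  ring

lemma poissonWeight_le_one (n : ℕ) {x : ℝ} (hx : 0 ≤ x) : poissonWeight n x ≤ 1 :=
  le_hasSum (hasSum_poissonWeight x) n fun k _ ↦ poissonWeight_nonneg k hx

variable {Ω : Type*} {m : MeasurableSpace Ω} {P : Measure Ω} {X : Ω → ℕ} {Λ : Ω → ℝ} {C : Set Ω}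

lemma hasSum_mul_measureReal [IsFiniteMeasure P] (hX : Measurable X) (C : Set Ω) {w : ℕ → ℝ}
    (hw : Integrable (fun ω ↦ w (X ω)) P) :
    HasSum (fun n ↦ w n * P.real (X ⁻¹' {n} ∩ C)) (∫ ω in C, w (X ω) ∂P) := by
  have hmeas : ∀ n, MeasurableSet (X ⁻¹' {n}) := fun n ↦ hX (measurableSet_singleton n)
  have hpt : ∀ (v : ℕ → ℝ) ω, HasSum (fun n ↦ (X ⁻¹' {n}).indicator (fun _ ↦ v n) ω) (v (X ω)) := by
    intro v ω
    convert hasSum_ite_eq (X ω) (v (X ω)) using 2 with n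
    by_cases h : n = X ω
    · simp [h]
    · simp [h, Ne.symm h]
  have h := hasSum_integral_of_dominated_convergence (μ := P.restrict C)
    (F := fun n ω ↦ (X ⁻¹' {n}).indicator (fun _ ↦ w n) ω) (f := fun ω ↦ w (X ω))
    (fun n ω ↦ (X ⁻¹' {n}).indicator (fun _ ↦ |w n|) ω)
    (fun n ↦ (measurable_const.indicator (hmeas n)).aestronglyMeasurable)
    (fun n ↦ Eventually.of_forall fun ω ↦ by
      by_cases h : X ω = n <;> simp [h])
    (Eventually.of_forall fun ω ↦ (hpt (fun n ↦ |w n|) ω).summable)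
    (by simpa only [(hpt (fun n ↦ |w n|) _).tsum_eq] using hw.abs.restrict)
    (Eventually.of_forall fun ω ↦ hpt w ω)
  refine h.congr_fun fun n ↦ ?_
  rw [integral_indicator (hmeas n), setIntegral_const, measureReal_restrict_apply (hmeas n),
    smul_eq_mul, mul_comm]

/-- Termwise integration by dominated convergence. As w may change sign, the Poisson mean v of |w|
supplies the integrable bound. -/
lemma hasSum_mul_setIntegral_poissonWeight (hΛ : Measurable Λ) (hΛ0 : ∀ᵐ ω ∂P, 0 ≤ Λ ω) (C : Set Ω)
    {w : ℕ → ℝ} {v f : ℝ → ℝ} (hv : ∀ x, 0 ≤ x → HasSum (fun n ↦ |w n| * poissonWeight n x) (v x))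
    (hvi : Integrable (fun ω ↦ v (Λ ω)) P)
    (hf : ∀ x, 0 ≤ x → HasSum (fun n ↦ w n * poissonWeight n x) (f x)) :
    HasSum (fun n ↦ w n * ∫ ω in C, poissonWeight n (Λ ω) ∂P) (∫ ω in C, f (Λ ω) ∂P) := by
  have h0 := ae_restrict_of_ae (s := C) hΛ0
  have h := hasSum_integral_of_dominated_convergence (μ := P.restrict C)
    (F := fun n ω ↦ w n * poissonWeight n (Λ ω)) (f := fun ω ↦ f (Λ ω))
    (fun n ω ↦ |w n| * poissonWeight n (Λ ω))
    (fun n ↦ (((measurable_poissonWeight n).comp hΛ).const_mul _).aestronglyMeasurable)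
    (fun n ↦ h0.mono fun ω h ↦ by
      rw [norm_mul, Real.norm_of_nonneg (poissonWeight_nonneg n h), Real.norm_eq_abs])
    (h0.mono fun ω h ↦ (hv _ h).summable)
    (hvi.integrableOn.congr (h0.mono fun ω h ↦ (hv _ h).tsum_eq.symm))
    (h0.mono fun ω h ↦ hf _ h)
  simpa only [integral_const_mul] using h

/-- The value at the mean `x` of the Poisson expectation of `w`. -/
noncomputable def poissonMean (w : ℕ → ℝ) (x : ℝ) : ℝ := ∑' n, w n * poissonWeight n x

lemma measurable_poissonMean (w : ℕ → ℝ) : Measurable (poissonMean w) :=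
  Measurable.tsum fun n ↦ (measurable_poissonWeight n).const_mul _

/-- Both sides of `h` expand as power series in z on [-1, 1]; their n-th coefficients are the two
sides of the conclusion. -/
lemma measureReal_eq_of_setIntegral_pow_eq [IsProbabilityMeasure P] (hX : Measurable X) (hΛ : Measurable Λ)
    (hΛ0 : ∀ᵐ ω ∂P, 0 ≤ Λ ω)
    (h : ∀ z : ℝ, |z| ≤ 1 →
      ∫ ω in C, z ^ X ω ∂P = ∫ ω in C, Real.exp (-((1 - z) * Λ ω)) ∂P) (n : ℕ) :
    P.real (X ⁻¹' {n} ∩ C) = ∫ ω in C, poissonWeight n (Λ ω) ∂P := by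
  refine congrFun (eq_of_hasSum_pow_mul (a := fun n ↦ P.real (X ⁻¹' {n} ∩ C))
    (b := fun n ↦ ∫ ω in C, poissonWeight n (Λ ω) ∂P) (f := fun z ↦ ∫ ω in C, z ^ X ω ∂P) (fun z hz ↦ ?_) fun z hz ↦ ?_) n
  · refine hasSum_mul_measureReal hX C (w := fun n ↦ z ^ n) ?_
    refine Integrable.of_bound
      ((Measurable.of_discrete (f := fun n : ℕ ↦ z ^ n)).comp hX).aestronglyMeasurable 1
      (Eventually.of_forall fun ω ↦ ?_)
    rw [Real.norm_eq_abs, abs_pow]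
    exact pow_le_one₀ (abs_nonneg _) hz
  · rw [h z hz]
    refine hasSum_mul_setIntegral_poissonWeight hΛ hΛ0 C (w := fun n ↦ z ^ n)
      (v := fun x ↦ Real.exp (-((1 - |z|) * x))) (f := fun x ↦ Real.exp (-((1 - z) * x)))
      (fun x _ ↦ ?_) ?_ fun x _ ↦ hasSum_pow_mul_poissonWeight z x
    · simpa only [abs_pow] using hasSum_pow_mul_poissonWeight |z| x
    · refine Integrable.of_bound (by fun_prop) 1 (hΛ0.mono fun ω h0 ↦ ?_)
      rw [Real.norm_eq_abs, Real.abs_exp, Real.exp_le_one_iff]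
      have := mul_nonneg (sub_nonneg.2 hz) h0
      linarith

lemma setIntegral_comp_eq_poissonMean [IsProbabilityMeasure P] (hX : Measurable X) (hΛ : Measurable Λ)
    (hΛ0 : ∀ᵐ ω ∂P, 0 ≤ Λ ω)
    (h : ∀ n : ℕ, P.real (X ⁻¹' {n} ∩ C) = ∫ ω in C, poissonWeight n (Λ ω) ∂P) {w : ℕ → ℝ}
    (hw : ∀ n, |w n| ≤ 1) :
    ∫ ω in C, w (X ω) ∂P = ∫ ω in C, poissonMean w (Λ ω) ∂P := by
  have h1 := hasSum_mul_measureReal hX C (w := w) (P := P) (Integrable.of_bound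
    ((Measurable.of_discrete (f := w)).comp hX).aestronglyMeasurable 1
    (Eventually.of_forall fun ω ↦ hw _))
  have hs : ∀ x, 0 ≤ x → Summable fun n ↦ |w n| * poissonWeight n x := fun x hx ↦
    Summable.of_nonneg_of_le (fun n ↦ mul_nonneg (abs_nonneg _) (poissonWeight_nonneg n hx))
      (fun n ↦ mul_le_of_le_one_left (poissonWeight_nonneg n hx) (hw n))
      (hasSum_poissonWeight x).summable
  have h2 := hasSum_mul_setIntegral_poissonWeight hΛ hΛ0 C (w := w)
    (v := poissonMean fun n ↦ |w n|) (f := poissonMean w) (fun x hx ↦ (hs x hx).hasSum) ?_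
    (fun x hx ↦ (Summable.of_norm ((hs x hx).congr fun n ↦ by
      rw [norm_mul, Real.norm_of_nonneg (poissonWeight_nonneg n hx), Real.norm_eq_abs])).hasSum)
  · simp only [h] at h1
    exact h1.unique h2
  · refine Integrable.of_bound ((measurable_poissonMean _).comp hΛ).aestronglyMeasurable 1
      (hΛ0.mono fun ω h0 ↦ ?_)
    rw [poissonMean, Real.norm_of_nonneg
      (tsum_nonneg fun n ↦ mul_nonneg (abs_nonneg _) (poissonWeight_nonneg n h0))]
    exact ((hs _ h0).tsum_le_tsum (fun n ↦ mul_le_of_le_one_left (poissonWeight_nonneg n h0) (hw n))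
      (hasSum_poissonWeight _).summable).trans_eq (hasSum_poissonWeight _).tsum_eq

lemma hasSum_nat_mul_setIntegral_poissonWeight (hΛ : Measurable Λ) (hΛ0 : ∀ᵐ ω ∂P, 0 ≤ Λ ω)
    (hΛi : Integrable Λ P) (C : Set Ω) :
    HasSum (fun n : ℕ ↦ (n : ℝ) * ∫ ω in C, poissonWeight n (Λ ω) ∂P) (∫ ω in C, Λ ω ∂P) :=
  hasSum_mul_setIntegral_poissonWeight hΛ hΛ0 C (w := fun n ↦ n) (v := id) (f := id)
    (fun x _ ↦ by simpa using hasSum_nat_mul_poissonWeight x) hΛi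
    fun x _ ↦ hasSum_nat_mul_poissonWeight x

/-- Summability of n P(X = n) is inherited from integrability of Λ. This makes the increments of N
integrable, so integrability of N propagates from time `⊥`. -/
lemma integrable_of_measureReal_eq [IsProbabilityMeasure P] (hX : Measurable X) (hΛ : Measurable Λ)
    (hΛ0 : ∀ᵐ ω ∂P, 0 ≤ Λ ω) (hΛi : Integrable Λ P)
    (h : ∀ n : ℕ, P.real (X ⁻¹' {n}) = ∫ ω, poissonWeight n (Λ ω) ∂P) :
    Integrable (fun ω ↦ (X ω : ℝ)) P := by
  refine ⟨((Measurable.of_discrete (f := fun n : ℕ ↦ (n : ℝ))).comp hX).aestronglyMeasurable, ?_⟩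
  have hs := (hasSum_nat_mul_setIntegral_poissonWeight hΛ hΛ0 hΛi univ).summable
  simp only [setIntegral_univ, ← h] at hs
  have e : ∫⁻ ω, ‖(X ω : ℝ)‖ₑ ∂P = ∑' n : ℕ, ENNReal.ofReal (n * P.real (X ⁻¹' {n})) := by
    rw [← lintegral_map (f := fun n : ℕ ↦ ‖(n : ℝ)‖ₑ) Measurable.of_discrete hX, lintegral_countable']
    congr 1 with n
    rw [Measure.map_apply hX (measurableSet_singleton n), ENNReal.ofReal_mul n.cast_nonneg,
      ofReal_measureReal, Real.enorm_of_nonneg n.cast_nonneg]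
  rw [HasFiniteIntegral, e]
  exact hs.tsum_ofReal_lt_top

lemma setIntegral_eq_of_measureReal_eq [IsProbabilityMeasure P] (hX : Measurable X) (hΛ : Measurable Λ)
    (hΛ0 : ∀ᵐ ω ∂P, 0 ≤ Λ ω) (hΛi : Integrable Λ P) (hXi : Integrable (fun ω ↦ (X ω : ℝ)) P)
    (h : ∀ n : ℕ, P.real (X ⁻¹' {n} ∩ C) = ∫ ω in C, poissonWeight n (Λ ω) ∂P) :
    ∫ ω in C, (X ω : ℝ) ∂P = ∫ ω in C, Λ ω ∂P := by
  have h1 := hasSum_mul_measureReal hX C (w := fun n ↦ n) hXi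
  simp only [h] at h1
  exact h1.unique (hasSum_nat_mul_setIntegral_poissonWeight hΛ hΛ0 hΛi C)

end PoissonWeights

section

variable {Ω : Type*} {𝒢 m : MeasurableSpace Ω} {P : Measure Ω}

/-! ### Conditional independence by successive conditioning -/

section CondIndep

/-- Events which are successively independent of the past given `𝒢` are conditionally independent
given `𝒢`. -/
lemma condExp_iInter_ae_eq_prod [IsProbabilityMeasure P] (h𝒢 : 𝒢 ≤ m) :
    ∀ (n : ℕ) (𝓗 : Fin n → MeasurableSpace Ω) (E : Fin n → Set Ω) (κ : Fin n → Ω → ℝ),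
      (∀ i, 𝒢 ≤ 𝓗 i) → (∀ i, 𝓗 i ≤ m) → (∀ i, MeasurableSet (E i)) →
      (∀ i j, i < j → MeasurableSet[𝓗 j] (E i)) → (∀ i, StronglyMeasurable[𝒢] (κ i)) →
      (∀ i, P⟦E i | 𝓗 i⟧ =ᵐ[P] κ i) → P⟦⋂ i, E i | 𝒢⟧ =ᵐ[P] fun ω ↦ ∏ i, κ i ω := by
  intro n
  induction n with
  | zero =>
    intro 𝓗 E κ _ _ _ _ _ _
    simp [condExp_const h𝒢]
  | succ n ih =>
    intro 𝓗 E κ h1 h2 hE hE' hκ hEκ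
    have ih' := ih (fun i ↦ 𝓗 i.castSucc) (fun i ↦ E i.castSucc) (fun i ↦ κ i.castSucc)
      (fun i ↦ h1 _) (fun i ↦ h2 _) (fun i ↦ hE _)
      (fun i j hij ↦ hE' _ _ (Fin.castSucc_lt_castSucc_iff.2 hij)) (fun i ↦ hκ _) (fun i ↦ hEκ _)
    set D : Set Ω := ⋂ i : Fin n, E i.castSucc with hD
    have hDm : MeasurableSet D := MeasurableSet.iInter fun i ↦ hE _
    have hDH : MeasurableSet[𝓗 (Fin.last n)] D := MeasurableSet.iInter fun i ↦ hE' _ _ (Fin.castSucc_lt_last i)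
    set f : Ω → ℝ := D.indicator fun _ ↦ 1
    set g : Ω → ℝ := (E (Fin.last n)).indicator fun _ ↦ 1
    have hfi : Integrable f P := (integrable_const 1).indicator hDm
    have hgi : Integrable g P := (integrable_const 1).indicator (hE _)
    have hfg : (⋂ i, E i).indicator (fun _ ↦ (1 : ℝ)) = f * g := by
      have : ⋂ i, E i = D ∩ E (Fin.last n) := by
        ext ω; simp [hD, Fin.forall_fin_succ']
      ext ω
      by_cases h : ω ∈ D <;> by_cases h' : ω ∈ E (Fin.last n) <;> simp [this, f, g, h, h']
    have hf1 : ∀ᵐ ω ∂P, ‖f ω‖ ≤ 1 := Eventually.of_forall fun ω ↦ by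
      by_cases h : ω ∈ D <;> simp [f, h]
    have hfm : StronglyMeasurable[𝓗 (Fin.last n)] f := stronglyMeasurable_const.indicator hDH
    have hκi : Integrable (κ (Fin.last n)) P := integrable_condExp.congr (hEκ (Fin.last n))
    -- Condition first on the σ-algebra of the last event, for which the earlier events are known,
    -- then on `𝒢`, for which the last conditional probability κ is known.
    have e1 : P[f * g | 𝓗 (Fin.last n)] =ᵐ[P] f * κ (Fin.last n) :=
      (condExp_mul_of_stronglyMeasurable_left hfm
        (hgi.bdd_mul hfi.aestronglyMeasurable hf1) hgi).trans (EventuallyEq.rfl.mul (hEκ _))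
    have e2 : P[f * g | 𝒢] =ᵐ[P] P[f | 𝒢] * κ (Fin.last n) :=
      ((condExp_condExp_of_le (h1 _) (h2 (Fin.last n))).symm.trans (condExp_congr_ae e1)).trans
        (condExp_mul_of_stronglyMeasurable_right (hκ _)
          (hκi.bdd_mul hfi.aestronglyMeasurable hf1) hfi)
    rw [hfg]
    filter_upwards [e2, ih'] with ω h3 h4
    rw [h3, Pi.mul_apply, h4, Fin.prod_univ_castSucc]

end CondIndep

/-! ### Conditional Poisson laws -/

section CondPoisson

/-- Given `𝒢`, the variable `X` has the Poisson distribution with mean `Λ`. -/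
def IsCondPoisson (P : Measure Ω) (𝒢 : MeasurableSpace Ω) (X : Ω → ℕ) (Λ : Ω → ℝ) : Prop :=
  ∀ C, MeasurableSet[𝒢] C → ∀ n : ℕ,
    P.real (X ⁻¹' {n} ∩ C) = ∫ ω in C, poissonWeight n (Λ ω) ∂P

variable {X : Ω → ℕ} {Λ : Ω → ℝ} [IsProbabilityMeasure P]

lemma integrable_poissonWeight_comp (hΛ : Measurable Λ) (hΛ0 : ∀ᵐ ω ∂P, 0 ≤ Λ ω) (n : ℕ) :
    Integrable (fun ω ↦ poissonWeight n (Λ ω)) P := by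
  refine Integrable.of_bound ((measurable_poissonWeight n).comp hΛ).aestronglyMeasurable 1
    (hΛ0.mono fun ω h ↦ ?_)
  rw [Real.norm_of_nonneg (poissonWeight_nonneg n h)]
  exact poissonWeight_le_one n h

lemma isCondPoisson_iff (h𝒢 : 𝒢 ≤ m) (hX : Measurable X) (hΛ : Measurable[𝒢] Λ)
    (hΛ0 : ∀ᵐ ω ∂P, 0 ≤ Λ ω) :
    IsCondPoisson P 𝒢 X Λ ↔
      ∀ n : ℕ, P⟦X ⁻¹' {n} | 𝒢⟧ =ᵐ[P] fun ω ↦ poissonWeight n (Λ ω) := by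
  have hXm : ∀ n, MeasurableSet (X ⁻¹' {n}) := fun n ↦ hX (measurableSet_singleton n)
  have hXi : ∀ n, Integrable ((X ⁻¹' {n}).indicator fun _ ↦ (1 : ℝ)) P := fun n ↦
    (integrable_const 1).indicator (hXm n)
  have hint : ∀ n (C : Set Ω), ∫ ω in C, (X ⁻¹' {n}).indicator (fun _ ↦ (1 : ℝ)) ω ∂P
      = P.real (X ⁻¹' {n} ∩ C) := fun n C ↦ by
    rw [integral_indicator (hXm n), setIntegral_const, measureReal_restrict_apply (hXm n), smul_eq_mul,
      mul_one]
  have hΛi := integrable_poissonWeight_comp (hΛ.mono h𝒢 le_rfl) hΛ0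
  constructor
  · intro h n
    refine (ae_eq_condExp_of_forall_setIntegral_eq h𝒢 (hXi n) (fun _ _ _ ↦ (hΛi n).integrableOn)
      (fun C hC _ ↦ ?_)
      ((measurable_poissonWeight n).comp hΛ).stronglyMeasurable.aestronglyMeasurable).symm
    rw [hint, h C hC n]
  · intro h C hC n
    rw [← hint, ← setIntegral_condExp h𝒢 (hXi n) hC]
    exact integral_congr_ae (ae_restrict_of_ae (h n))

/-- The conditional probability is a function of Λ alone, which is what later allows `𝒢` to be
shrunk. Y stands for the real difference of values of N, which agrees only almost surely with the
truncated difference X. -/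
lemma IsCondPoisson.condExp_preimage (h : IsCondPoisson P 𝒢 X Λ) (h𝒢 : 𝒢 ≤ m) (hX : Measurable X)
    (hΛ : Measurable[𝒢] Λ) (hΛ0 : ∀ᵐ ω ∂P, 0 ≤ Λ ω) {Y : Ω → ℝ}
    (hY : Y =ᵐ[P] fun ω ↦ (X ω : ℝ)) {B : Set ℝ} :
    P⟦Y ⁻¹' B | 𝒢⟧ =ᵐ[P]
      fun ω ↦ poissonMean (fun n ↦ B.indicator (fun _ ↦ 1) (n : ℝ)) (Λ ω) := by
  set w : ℕ → ℝ := fun n ↦ B.indicator (fun _ ↦ 1) (n : ℝ) with hw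
  have hw1 : ∀ n, |w n| ≤ 1 := fun n ↦ by
    by_cases h : (n : ℝ) ∈ B <;> simp [hw, h]
  have hYX : (Y ⁻¹' B).indicator (fun _ ↦ (1 : ℝ)) =ᵐ[P] fun ω ↦ w (X ω) := by
    filter_upwards [hY] with ω h
    by_cases h' : (X ω : ℝ) ∈ B <;> simp [hw, h, h']
  refine (condExp_congr_ae hYX).trans (ae_eq_condExp_of_forall_setIntegral_eq h𝒢 ?_ ?_ ?_ ?_).symm
  · exact Integrable.of_bound ((Measurable.of_discrete (f := w)).comp hX).aestronglyMeasurable 1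
      (Eventually.of_forall fun ω ↦ hw1 _)
  · intro C _ _
    refine Integrable.integrableOn (Integrable.of_bound
      ((measurable_poissonMean w).comp (hΛ.mono h𝒢 le_rfl)).aestronglyMeasurable 1
      (hΛ0.mono fun ω h0 ↦ ?_))
    refine (tsum_of_norm_bounded (hasSum_poissonWeight (Λ ω)) fun n ↦ ?_)
    rw [norm_mul, Real.norm_of_nonneg (poissonWeight_nonneg n h0)]
    exact mul_le_of_le_one_left (poissonWeight_nonneg n h0) (hw1 n)
  · intro C hC _
    exact (setIntegral_comp_eq_poissonMean hX (hΛ.mono h𝒢 le_rfl) hΛ0 (h C hC) hw1).symm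
  · exact ((measurable_poissonMean w).comp hΛ).stronglyMeasurable.aestronglyMeasurable

end CondPoisson

/-! ### Independence of successive increments -/

section Increments

variable {T : ℝ≥0} {𝓕 : Filtration (Iic T) m} {N : Iic T → Ω → ℕ} {A : Iic T → Ω → ℝ}

lemma natCast_sub_ae_eq (hNm : ∀ᵐ ω ∂P, Monotone fun t ↦ N t ω) {s t : Iic T} (hst : s ≤ t) :
    (fun ω ↦ (N t ω : ℝ) - N s ω) =ᵐ[P] fun ω ↦ ((N t ω - N s ω : ℕ) : ℝ) := by
  filter_upwards [hNm] with ω h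
  rw [Nat.cast_sub (h hst)]

/-- Increments with conditional Poisson distributions over successive intervals are conditionally
independent given a σ-algebra of the past which determines the means. -/
lemma condIndepGiven_increments [IsProbabilityMeasure P] (hN : Adapted 𝓕 N) (hNm : ∀ᵐ ω ∂P, Monotone fun t ↦ N t ω)
    (hAm : ∀ᵐ ω ∂P, Monotone fun t ↦ A t ω) (hA : ∀ t, Measurable[𝒢] (A t))
    {n : ℕ} {s t : Fin n → Iic T} (hst : ∀ i, s i ≤ t i) (hts : ∀ i j, i < j → t i ≤ s j)
    (h𝒢m : 𝒢 ≤ m) (h𝒢 : ∀ i, 𝒢 ≤ 𝓕 (s i))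
    (h : ∀ i, IsCondPoisson P (𝓕 (s i)) (fun ω ↦ N (t i) ω - N (s i) ω)
      fun ω ↦ A (t i) ω - A (s i) ω) :
    CondIndepGiven P 𝒢 fun i ω ↦ (N (t i) ω : ℝ) - N (s i) ω := by
  intro B hB
  have hN' : ∀ {u v}, u ≤ v → Measurable[𝓕 v] fun ω ↦ (N u ω : ℝ) := fun huv ↦
    Measurable.of_discrete.comp ((hN _).mono (𝓕.mono huv) le_rfl)
  have hY : ∀ i v, t i ≤ v → Measurable[𝓕 v] fun ω ↦ (N (t i) ω : ℝ) - N (s i) ω :=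
    fun i v hv ↦ (hN' hv).sub (hN' ((hst i).trans hv))
  have hX : ∀ i, Measurable fun ω ↦ N (t i) ω - N (s i) ω := fun i ↦
    ((hN _).mono (𝓕.le _) le_rfl).sub ((hN _).mono (𝓕.le _) le_rfl)
  have hκ := fun i ↦ (h i).condExp_preimage (𝓕.le _) (hX i)
    (((hA _).sub (hA _)).mono (h𝒢 i) le_rfl)
    (hAm.mono fun ω hm ↦ sub_nonneg.2 (hm (hst i))) (natCast_sub_ae_eq hNm (hst i)) (B := B i)
  have hκm := fun i ↦ ((measurable_poissonMean fun n ↦ (B i).indicator (fun _ ↦ 1) (n : ℝ)).comp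
    ((hA (t i)).sub (hA (s i)))).stronglyMeasurable
  refine (condExp_iInter_ae_eq_prod h𝒢m n (fun i ↦ 𝓕 (s i)) _ _ h𝒢 (fun i ↦ 𝓕.le _)
    (fun i ↦ 𝓕.le _ _ (hY i _ le_rfl (hB i))) (fun i j hij ↦ hY i _ (hts i j hij) (hB i))
    hκm hκ).trans ?_
  have hκ' : ∀ i, P⟦(fun ω ↦ (N (t i) ω : ℝ) - N (s i) ω) ⁻¹' B i | 𝒢⟧ =ᵐ[P]
      fun ω ↦ poissonMean (fun n ↦ (B i).indicator (fun _ ↦ 1) (n : ℝ)) (A (t i) ω - A (s i) ω) :=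
    fun i ↦ by
      -- The law given `𝓕 (s i)` is already `𝒢`-measurable, so conditioning further on `𝒢` leaves it
      -- unchanged.
      refine (condExp_condExp_of_le (h𝒢 i) (𝓕.le _)).symm.trans ((condExp_congr_ae (hκ i)).trans ?_)
      exact (condExp_of_stronglyMeasurable h𝒢m (hκm i)
        (integrable_condExp.congr (hκ i))).eventuallyEq
  filter_upwards [ae_all_iff.2 hκ'] with ω h'
  exact Finset.prod_congr rfl fun i _ ↦ (h' i).symm

end Increments

end

/-! ### The two implications -/

section Characterization

variable {Ω : Type*} {m : MeasurableSpace Ω} {P : Measure Ω} {T : ℝ≥0}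
  {𝓕 : Filtration (Iic T) m} {N : Iic T → Ω → ℕ} {A : Iic T → Ω → ℝ}

lemma measurable_sigmaGen {ι : Type*} (Y : ι → Ω → ℝ) (t : ι) : Measurable[sigmaGen Y] (Y t) :=
  (comap_measurable (Y t)).mono
    (le_iSup (fun t ↦ (inferInstance : MeasurableSpace ℝ).comap (Y t)) t) le_rfl

lemma setOf_natCast_sub_eq_ae (hNm : ∀ᵐ ω ∂P, Monotone fun t ↦ N t ω) {s t : Iic T} (hst : s ≤ t)
    (n : ℕ) :
    ({ω | (N t ω : ℝ) - N s ω = n}.indicator fun _ ↦ (1 : ℝ)) =ᵐ[P]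
      ((fun ω ↦ N t ω - N s ω) ⁻¹' {n}).indicator fun _ ↦ 1 := by
  filter_upwards [natCast_sub_ae_eq hNm hst] with ω h
  by_cases h' : N t ω - N s ω = n
  · rw [indicator_of_mem, indicator_of_mem]
    · exact h'
    · exact h.trans (by rw [h'])
  · rw [indicator_of_notMem, indicator_of_notMem]
    · exact h'
    · intro h2
      exact h' (Nat.cast_injective (h.symm.trans h2))

lemma condPoisson_iff [IsProbabilityMeasure P] (hN : Adapted 𝓕 N)
    (hA : ∀ t, Measurable[𝓕 ⊥] (A t))
    (hNm : ∀ᵐ ω ∂P, Monotone fun t ↦ N t ω) (hAm : ∀ᵐ ω ∂P, Monotone fun t ↦ A t ω)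
    {s t : Iic T} (hst : s ≤ t) :
    (∀ n : ℕ, P⟦{ω | (N t ω : ℝ) - N s ω = n} | 𝓕 s⟧
      =ᵐ[P] fun ω ↦ (A t ω - A s ω) ^ n * Real.exp (A s ω - A t ω) / (n.factorial : ℝ)) ↔
    IsCondPoisson P (𝓕 s) (fun ω ↦ N t ω - N s ω) fun ω ↦ A t ω - A s ω := by
  have hA' : ∀ u, Measurable[𝓕 s] (A u) := fun u ↦ (hA u).mono (𝓕.mono bot_le) le_rfl
  rw [isCondPoisson_iff (X := fun ω ↦ N t ω - N s ω) (Λ := fun ω ↦ A t ω - A s ω) (𝓕.le s)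
    (((hN t).mono (𝓕.le t) le_rfl).sub ((hN s).mono (𝓕.le s) le_rfl)) ((hA' t).sub (hA' s))
    (hAm.mono fun ω h ↦ sub_nonneg.2 (h hst))]
  refine forall_congr' fun n ↦ ?_
  have h := condExp_congr_ae (m := 𝓕 s) (setOf_natCast_sub_eq_ae (P := P) hNm hst n)
  simp only [poissonWeight, neg_sub]
  exact ⟨h.symm.trans, h.trans⟩

lemma integrable_of_monotone (hA : ∀ t, Measurable (A t)) (hAm : ∀ᵐ ω ∂P, Monotone fun t ↦ A t ω)
    (h0 : Integrable (A ⊥) P) (h1 : Integrable (A ⊤) P) (t : Iic T) : Integrable (A t) P := by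
  refine Integrable.mono' (h0.abs.add h1.abs) (hA t).aestronglyMeasurable ?_
  filter_upwards [hAm] with ω h
  have h2 : A ⊥ ω ≤ A t ω := h bot_le
  have h3 : A t ω ≤ A ⊤ ω := h le_top
  have h4 := neg_abs_le (A ⊥ ω)
  have h5 := le_abs_self (A ⊤ ω)
  have h6 := abs_nonneg (A ⊥ ω)
  have h7 := abs_nonneg (A ⊤ ω)
  simp only [Pi.add_apply, Real.norm_eq_abs]
  exact abs_le.2 ⟨by linarith, by linarith⟩

/-- Both paths are monotone, so the absolute values are signed increments, whose expectations agree
by the martingale property. -/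
lemma integral_abs_sub_eq [IsProbabilityMeasure P]
    (hNm : ∀ᵐ ω ∂P, Monotone fun t ↦ N t ω) (hAm : ∀ᵐ ω ∂P, Monotone fun t ↦ A t ω)
    (hNi : ∀ t, Integrable (fun ω ↦ (N t ω : ℝ)) P) (hAi : ∀ t, Integrable (A t) P)
    (hM : Martingale (fun t ω ↦ (N t ω : ℝ) - A t ω) 𝓕 P) (s t : Iic T) :
    ∫ ω, |(N s ω : ℝ) - N t ω| ∂P = ∫ ω, |A s ω - A t ω| ∂P := by
  wlog hst : s ≤ t generalizing s t
  · simpa only [abs_sub_comm] using this t s (le_of_not_ge hst)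
  have h := integral_mul_martingale_sub hM hst (d := 1) (K := 1) stronglyMeasurable_one
    (Eventually.of_forall fun ω ↦ by simp)
  have e : ∫ ω, (1 : Ω → ℝ) ω * (((N t ω : ℝ) - A t ω) - (N s ω - A s ω)) ∂P
      = ∫ ω, |(N s ω : ℝ) - N t ω| - |A s ω - A t ω| ∂P := by
    refine integral_congr_ae ?_
    filter_upwards [hNm, hAm] with ω h1 h2
    have h3 : (N s ω : ℝ) ≤ N t ω := Nat.cast_le.2 (h1 hst)
    have h4 : A s ω ≤ A t ω := h2 hst
    rw [abs_of_nonpos (sub_nonpos.2 h3), abs_of_nonpos (sub_nonpos.2 h4), Pi.one_apply]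
    ring
  have hi1 : Integrable (fun ω ↦ |(N s ω : ℝ) - N t ω|) P := ((hNi s).sub (hNi t)).abs
  have hi2 : Integrable (fun ω ↦ |A s ω - A t ω|) P := ((hAi s).sub (hAi t)).abs
  rw [e, integral_sub hi1 hi2] at h
  exact sub_eq_zero.1 h

lemma tendsto_measure_le_abs_sub_add [IsProbabilityMeasure P]
    (hNm : ∀ᵐ ω ∂P, Monotone fun t ↦ N t ω) (hAp : IsIncreasingAC P A)
    (hNi : ∀ t, Integrable (fun ω ↦ (N t ω : ℝ)) P) (hAi : ∀ t, Integrable (A t) P)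
    (hM : Martingale (fun t ω ↦ (N t ω : ℝ) - A t ω) 𝓕 P) (t : Iic T) {ε : ℝ} (hε : 0 < ε) :
    Tendsto (fun s ↦ P {ω | ε ≤ |(N s ω : ℝ) - N t ω| + |A s ω - A t ω|}) (𝓝 t) (𝓝 0) := by
  have hAm : ∀ᵐ ω ∂P, Monotone fun t ↦ A t ω := hAp.mono fun ω h ↦ h.1
  have hlim : Tendsto (fun s ↦ ∫ ω, |A s ω - A t ω| ∂P) (𝓝 t) (𝓝 (∫ _, 0 ∂P)) := by
    refine tendsto_integral_filter_of_dominated_convergence (fun ω ↦ A ⊤ ω - A ⊥ ω)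
      (Eventually.of_forall fun s ↦ ((hAi s).sub (hAi t)).abs.aestronglyMeasurable)
      (Eventually.of_forall fun s ↦ ?_) ((hAi ⊤).sub (hAi ⊥)) ?_
    · filter_upwards [hAm] with ω h
      rw [Real.norm_eq_abs, abs_abs]
      have h1 : A ⊥ ω ≤ A s ω := h bot_le
      have h2 : A s ω ≤ A ⊤ ω := h le_top
      have h3 : A ⊥ ω ≤ A t ω := h bot_le
      have h4 : A t ω ≤ A ⊤ ω := h le_top
      exact abs_le.2 ⟨by linarith, by linarith⟩
    · filter_upwards [hAp] with ω h
      have hc := (continuous_of_absolutelyContinuousOnInterval h.2).tendsto t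
      simpa using (hc.sub_const (A t ω)).abs
  have hlim' : Tendsto (fun s ↦ ENNReal.ofReal (ε⁻¹ * (2 * ∫ ω, |A s ω - A t ω| ∂P))) (𝓝 t)
      (𝓝 0) := by
    rw [integral_zero] at hlim
    simpa using ENNReal.tendsto_ofReal ((hlim.const_mul 2).const_mul ε⁻¹)
  refine tendsto_of_tendsto_of_tendsto_of_le_of_le tendsto_const_nhds hlim'
    (fun s ↦ zero_le) fun s ↦ ?_
  have hi1 : Integrable (fun ω ↦ |(N s ω : ℝ) - N t ω|) P := ((hNi s).sub (hNi t)).abs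
  have hi2 : Integrable (fun ω ↦ |A s ω - A t ω|) P := ((hAi s).sub (hAi t)).abs
  have hmarkov := mul_meas_ge_le_integral_of_nonneg (μ := P)
    (f := fun ω ↦ |(N s ω : ℝ) - N t ω| + |A s ω - A t ω|)
    (Eventually.of_forall fun ω ↦ add_nonneg (abs_nonneg _) (abs_nonneg _)) (hi1.add hi2) ε
  have hsum : ∫ ω, |(N s ω : ℝ) - N t ω| + |A s ω - A t ω| ∂P = 2 * ∫ ω, |A s ω - A t ω| ∂P := by
    rw [integral_add hi1 hi2, integral_abs_sub_eq hNm hAm hNi hAi hM s t, two_mul]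
  rw [hsum] at hmarkov
  dsimp only
  rw [← ofReal_measureReal]
  exact ENNReal.ofReal_le_ofReal ((le_inv_mul_iff₀ hε).2 hmarkov)

lemma isCondPoisson_of_martingale [IsProbabilityMeasure P] (hN : Adapted 𝓕 N)
    (hA : ∀ t, Measurable[𝓕 ⊥] (A t)) (hNp : IsPointProcess P N) (hAp : IsIncreasingAC P A)
    (hNi : ∀ t, Integrable (fun ω ↦ (N t ω : ℝ)) P) (hAi : ∀ t, Integrable (A t) P)
    (hM : Martingale (fun t ω ↦ (N t ω : ℝ) - A t ω) 𝓕 P) {s t : Iic T} (hst : s ≤ t) :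
    IsCondPoisson P (𝓕 s) (fun ω ↦ N t ω - N s ω) fun ω ↦ A t ω - A s ω := by
  have hA' : ∀ t, Measurable (A t) := fun t ↦ (hA t).mono (𝓕.le _) le_rfl
  intro C hC n
  exact measureReal_eq_of_setIntegral_pow_eq
    (((hN t).mono (𝓕.le t) le_rfl).sub ((hN s).mono (𝓕.le s) le_rfl))
    ((hA' t).sub (hA' s)) (hAp.mono fun ω h ↦ sub_nonneg.2 (h.1 hst))
    (fun z hz ↦ setIntegral_pow_sub_eq hN hA hNp hAp hNi hAi hM hz hst hC) n

theorem isPoissonAdditive_of_martingale [IsProbabilityMeasure P] (hN : Adapted 𝓕 N)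
    (hAσ : sigmaGen A ≤ 𝓕 ⊥) (hNp : IsPointProcess P N) (hAp : IsIncreasingAC P A)
    (hAi : ∀ t, Integrable (A t) P)
    (hM : Martingale (fun t ω ↦ (N t ω : ℝ) - A t ω) 𝓕 P) : IsPoissonAdditive 𝓕 P N A := by
  have hA : ∀ t, Measurable[𝓕 ⊥] (A t) := fun t ↦ (measurable_sigmaGen A t).mono hAσ le_rfl
  have hNm : ∀ᵐ ω ∂P, Monotone fun t ↦ N t ω := hNp.mono fun ω h ↦ h.1
  have hAm : ∀ᵐ ω ∂P, Monotone fun t ↦ A t ω := hAp.mono fun ω h ↦ h.1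
  have hNi : ∀ t, Integrable (fun ω ↦ (N t ω : ℝ)) P := fun t ↦
    ((hM.integrable t).add (hAi t)).congr (Eventually.of_forall fun ω ↦ by simp)
  have hpois : ∀ {s t : Iic T}, s ≤ t →
      IsCondPoisson P (𝓕 s) (fun ω ↦ N t ω - N s ω) fun ω ↦ A t ω - A s ω :=
    isCondPoisson_of_martingale hN hA hNp hAp hNi hAi hM
  refine ⟨⟨fun t ε hε ↦ tendsto_measure_le_abs_sub_add hNm hAp hNi hAi hM t hε, ?_⟩, hN, hAσ,
    fun s t hst ↦ (condPoisson_iff hN hA hNm hAm hst.le).2 (hpois hst.le), ?_⟩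
  · intro n t ht
    exact condIndepGiven_increments hN hNm hAm (measurable_sigmaGen A)
      (s := fun k ↦ t k.castSucc) (t := fun k ↦ t k.succ)
      (fun i ↦ ht.monotone i.castSucc_lt_succ.le)
      (fun i j hij ↦ ht.monotone (Fin.succ_le_castSucc_iff.2 hij))
      (hAσ.trans (𝓕.le _)) (fun i ↦ hAσ.trans (𝓕.mono bot_le))
      fun i ↦ hpois (ht.monotone i.castSucc_lt_succ.le)
  · intro s t u v hst htu huv
    have hle : ∀ i, ![s, u] i ≤ ![t, v] i := by
      intro i; fin_cases i <;> simp [hst.le, huv.le]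
    -- The case of two intervals, with `𝓕 s` in place of the σ-algebra generated by A.
    have h := condIndepGiven_increments hN hNm hAm (𝒢 := 𝓕 s)
      (fun t ↦ (hA t).mono (𝓕.mono bot_le) le_rfl) (s := ![s, u]) (t := ![t, v]) hle
      (fun i j hij ↦ by fin_cases i <;> fin_cases j <;> simp_all)
      (𝓕.le s) (fun i ↦ 𝓕.mono (by fin_cases i <;> simp [hst.le.trans htu]))
      fun i ↦ hpois (hle i)
    convert h using 1
    funext i
    fin_cases i <;> rfl

theorem martingale_of_isCondPoisson [IsProbabilityMeasure P] (hN : Adapted 𝓕 N)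
    (hA : ∀ t, Measurable[𝓕 ⊥] (A t)) (hNm : ∀ᵐ ω ∂P, Monotone fun t ↦ N t ω)
    (hAm : ∀ᵐ ω ∂P, Monotone fun t ↦ A t ω) (hN0 : Integrable (fun ω ↦ (N ⊥ ω : ℝ)) P)
    (hAi : ∀ t, Integrable (A t) P)
    (h : ∀ s t : Iic T, s < t →
      IsCondPoisson P (𝓕 s) (fun ω ↦ N t ω - N s ω) fun ω ↦ A t ω - A s ω) :
    Martingale (fun t ω ↦ (N t ω : ℝ) - A t ω) 𝓕 P := by
  have hA' : ∀ t, Measurable (A t) := fun t ↦ (hA t).mono (𝓕.le _) le_rfl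
  have hX : ∀ s t, Measurable fun ω ↦ N t ω - N s ω := fun s t ↦
    ((hN t).mono (𝓕.le t) le_rfl).sub ((hN s).mono (𝓕.le s) le_rfl)
  have hΛ0 : ∀ {s t : Iic T}, s ≤ t → ∀ᵐ ω ∂P, 0 ≤ A t ω - A s ω := fun hst ↦
    hAm.mono fun ω h ↦ sub_nonneg.2 (h hst)
  have hXi : ∀ s t, s < t → Integrable (fun ω ↦ ((N t ω - N s ω : ℕ) : ℝ)) P := fun s t hst ↦
    integrable_of_measureReal_eq (hX s t) ((hA' t).sub (hA' s)) (hΛ0 hst.le)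
      ((hAi t).sub (hAi s)) fun n ↦ by simpa using h s t hst univ MeasurableSet.univ n
  have hNi : ∀ t, Integrable (fun ω ↦ (N t ω : ℝ)) P := by
    intro t
    rcases eq_bot_or_bot_lt t with rfl | ht
    · exact hN0
    · refine (hN0.add (hXi _ _ ht)).congr ?_
      filter_upwards [natCast_sub_ae_eq hNm ht.le] with ω hω
      rw [Pi.add_apply, ← hω]
      ring
  have hadapt : StronglyAdapted 𝓕 fun t ω ↦ (N t ω : ℝ) - A t ω := fun t ↦
    (((Measurable.of_discrete (f := fun n : ℕ ↦ (n : ℝ))).comp (hN t)).sub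
      ((hA t).mono (𝓕.mono bot_le) le_rfl)).stronglyMeasurable
  have hMi : ∀ t, Integrable (fun ω ↦ (N t ω : ℝ) - A t ω) P := fun t ↦ (hNi t).sub (hAi t)
  refine ⟨hadapt, fun s t hst ↦ ?_⟩
  -- The conditional law is given only for s < t, so the diagonal case is treated apart.
  rcases hst.eq_or_lt with rfl | hlt
  · rw [condExp_of_stronglyMeasurable (𝓕.le s) (hadapt s) (hMi s)]
  refine (ae_eq_condExp_of_forall_setIntegral_eq (𝓕.le s) (hMi t)
    (fun _ _ _ ↦ (hMi s).integrableOn) (fun C hC _ ↦ ?_) (hadapt s).aestronglyMeasurable).symm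
  have hC' := setIntegral_eq_of_measureReal_eq (hX s t) ((hA' t).sub (hA' s)) (hΛ0 hst)
    ((hAi t).sub (hAi s)) (hXi s t hlt) (h s t hlt C hC)
  rw [← integral_congr_ae (ae_restrict_of_ae (natCast_sub_ae_eq hNm hst)),
    integral_sub (hNi t).integrableOn (hNi s).integrableOn] at hC'
  simp only [Pi.sub_apply] at hC'
  rw [integral_sub (hAi t).integrableOn (hAi s).integrableOn] at hC'
  rw [integral_sub (hNi s).integrableOn (hAi s).integrableOn,
    integral_sub (hNi t).integrableOn (hAi t).integrableOn]
  linarith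

end Characterization

end PoissonAdditive

/-- The time set is `[0, T]`, i.e. the type `Set.Iic T` with `T : ℝ≥0`, whose least and greatest
elements `⊥` and `⊤` are the times `0` and `T`. -/
theorem theorem2p2 {Ω : Type*} [m : MeasurableSpace Ω] (P : Measure Ω) [IsProbabilityMeasure P]
    (T : ℝ≥0) (hT : 0 < T) (𝓕 : Filtration (Set.Iic T) m)
    (N : Set.Iic T → Ω → ℕ) (A : Set.Iic T → Ω → ℝ)
    (hN_adapted : Adapted 𝓕 N)
    (hN_point : PoissonAdditive.IsPointProcess P N)
    (hN_int : Integrable (fun ω ↦ (N ⊥ ω : ℝ)) P)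
    (hA_pred : IsStronglyPredictable 𝓕 A)
    (hA_path : PoissonAdditive.IsIncreasingAC P A)
    (hA_int_zero : Integrable (A ⊥) P)
    (hA_int : Integrable (A ⊤) P)
    (hA_sigma : PoissonAdditive.sigmaGen A ≤ 𝓕 ⊥) :
    PoissonAdditive.IsPoissonAdditive 𝓕 P N A ↔
      Martingale (fun t ω ↦ (N t ω : ℝ) - A t ω) 𝓕 P := by
  have hA : ∀ t, Measurable[𝓕 ⊥] (A t) := fun t ↦
    (PoissonAdditive.measurable_sigmaGen A t).mono hA_sigma le_rfl
  have hNm : ∀ᵐ ω ∂P, Monotone fun t ↦ N t ω := hN_point.mono fun ω h ↦ h.1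
  have hAm : ∀ᵐ ω ∂P, Monotone fun t ↦ A t ω := hA_path.mono fun ω h ↦ h.1
  have hAi := PoissonAdditive.integrable_of_monotone (P := P)
    (fun t ↦ (hA t).mono (𝓕.le _) le_rfl) hAm hA_int_zero hA_int
  refine ⟨fun h ↦ ?_, PoissonAdditive.isPoissonAdditive_of_martingale hN_adapted hA_sigma hN_point
    hA_path hAi⟩
  exact PoissonAdditive.martingale_of_isCondPoisson hN_adapted hA hNm hAm hN_int hAi
    fun s t hst ↦ (PoissonAdditive.condPoisson_iff hN_adapted hA hNm hAm hst.le).1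
      (h.condPoisson s t hst)
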